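/- **Model.** $L$ is a finite set of locations. In every period a mass $\theta_i\ge 0$ of riders appears at $i\in L$; a fraction $\alpha_{ij}\ge 0$ ($\sum_j\alpha_{ij}=1$) wants to go to $j$, and willingness to pay has CDF $F$. Drivers form a continuum (a measure space $\Omega$ in which points are null). Each driver has a type in $L$, her preferred location, and gets utility $I\ge 0$ whenever she starts a period there. Drivers discount by $\delta\in(0,1)$ and have an outside option $w\ge 0$ with $I/(1-\delta)<w$. Put $W=w(1-\delta)$. Every trip takes one period. **PARM.** Drivers report types; let $s^{(\tau)}\in[0,\infty]$ be the mass reporting $\tau$. PARM chooses prices $p_{ij}\ge 0$, rider flows $f_{ij}^{(\tau)}\ge 0$, empty relocation flows $y_{ij}^{(\tau)}\ge 0$ and driver masses $x_i^{(\tau)}\ge 0$ that maximize $$\sum_{i,j,\tau} f_{ij}^{(\tau)}p_{ij}-W\sum_{i,\tau}x_i^{(\tau)}+I\sum_\tau x_\tau^{(\tau)}$$ subject to $x_i^{(\tau)}=\sum_j (f_{ji}^{(\tau)}+y_{ji}^{(\tau)})$, $x_i^{(\tau)}=\sum_j (f_{ij}^{(\tau)}+y_{ij}^{(\tau)})$,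 $\sum_\tau f_{ij}^{(\tau)}=\theta_i\alpha_{ij}(1-F(p_{ij}))$, $x^{(\tau)}:=\sum_i x_i^{(\tau)}\le s^{(\tau)}$ and $x_\tau^{(\tau)}\ge x_i^{(\tau)}$ for all $i,j,\tau$. A driver treated as type $\tau$ who serves at $i$ is dispatched to $j$ with probability $(f_{ij}^{(\tau)}+y_{ij}^{(\tau)})/x_i^{(\tau)}$ (she stays at $i$ if $x_i^{(\tau)}=0$) and is paid $W-I\cdot\mathbf 1\{i=\tau\}$. Instead of serving, a driver may relocate unpaid to any $j$; if $j$ differs from the type $\tau$ as which she is currently treated, she is treated as type $j$ from then on and, if this is her first such deviation, pays $P_\tau=\max\{\max_k P^{k\to\tau},0\}$. For each employed type $\tau$ (that is, $x^{(\tau)}>0$), the numbers $P^{k\to\tau}$, $k\in L$, solve, together with $\pi_i^{k\to\tau}$, $$\pi_i^{k\to\tau}=\mathbf 1\{i\ne\tau\}\Big(W+\delta\sum_j\tfrac{f_{ij}^{(\tau)}+y_{ij}^{(\tau)}}{x_i^{(\tau)}}\pi_j^{k\to\tau}\Big)+\mathbf 1\{i=\tau\}(\delta w-P^{k\to\tau})+\mathbf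 1\{i=k\}I\quad(i,k\in L),$$ $$w=\sum_i\pi_i^{k\to\tau}x_i^{(\tau)}/x^{(\tau)}\quad(k\in L),$$ where $0/0=0$. A driver who reports an employed type $\tau$ starts at $i$ with probability $x_i^{(\tau)}/x^{(\tau)}$; one who reports a type that is not employed takes the outside option. A plan chooses, possibly at random and depending on the driver's past states and actions, whether to serve or where to relocate. Utilities are expected discounted lifetime utilities when the other drivers report truthfully and always serve. **Theorem.** Truthful reporting and always providing service is an ex post Nash equilibrium under PARM: for every profile of true types at whose supply the maximization problem has a solution, no driver can gain by any report followed by any plan. Moreover, for every supply $s$ at which the problem has a solution: 1. the discounted series of expected per-period utilities that defines lifetime utility converges for all plans, true types, reports and initial locations; 2. a truthful driver who always serves gets exactly $w$; 3. for every employed type $\tau$ the linear system has exactly one solution $(\pi_i^{k\to\tau},P^{k\to\tau})_{i,k\in L}$; 4. for every employed $\tau$ and true type $k\neq\tau$, the strategy "report $\tau$, serve everywhere except at $\tau$, from there relocate to $k$, then always serve" gives at most $w$, and after the misreport $\tau$ no plan is better than the better one of this strategy and always serving. -/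

import Mathlib

namespace Ridesharing

/-- A ridesharing economy on the finite set `L` of locations.  `θ i` is the mass of riders at `i`,
`α i j` the fraction of them going to `j`, `ν` the law of a rider's willingness to pay, `I` the
utility of starting a period in the preferred location, `δ` the discount factor and `w` the drivers'
outside option. -/
structure Economy (L : Type*) [Fintype L] where
  θ : L → ℝ
  α : L → L → ℝ
  ν : MeasureTheory.ProbabilityMeasure ℝ
  I : ℝ
  δ : ℝ
  w : ℝ
  θ_nonneg : ∀ i, 0 ≤ θ i
  α_nonneg : ∀ i j, 0 ≤ α i j
  α_sum : ∀ i, ∑ j, α i j = 1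
  I_nonneg : 0 ≤ I
  δ_pos : 0 < δ
  δ_lt_one : δ < 1
  w_nonneg : 0 ≤ w
  I_lt : I / (1 - δ) < w

/-- Trip prices and flows: `p i j` is the price of a trip from `i` to `j`, `f i j τ` the mass of
riders from `i` to `j` served by drivers of reported type `τ`, `y i j τ` the mass of drivers of
reported type `τ` relocated from `i` to `j` without a rider, and `x i τ` the mass of drivers of
reported type `τ` at `i`. -/
structure Assignment (L : Type*) where
  p : L → L → ℝ
  f : L → L → L → ℝ
  y : L → L → L → ℝ
  x : L → L → ℝ

/-- What a mechanism announces: prices and flows, the compensation `c i j τ` for a dispatch from `i`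
to `j` of a driver of reported type `τ`, and the penalty `pen τ` for the first deviation of a driver
of reported type `τ`. -/
structure Outcome (L : Type*) extends Assignment L where
  c : L → L → L → ℝ
  pen : L → ℝ

/-- The situation of a driver at the beginning of a period: her location, the type as which the
platform currently treats her, and whether she has already made a first deviation. -/
structure DriverState (L : Type*) where
  loc : L
  typ : L
  deviated : Bool

/-- `none`: provide service.  `some j`: do not provide service and relocate to `j`. -/
abbrev Action (L : Type*) := Option L

/-- A (possibly randomized) plan of behaviour: given the driver's past states and actions and her
current state, the probability of each action. -/
structure Plan (L : Type*) [Fintype L] where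
  prob : List (DriverState L × Action L) → DriverState L → Action L → ℝ
  prob_nonneg : ∀ h st a, 0 ≤ prob h st a
  prob_sum : ∀ h st, ∑ a, prob h st a = 1

variable {L : Type*} [Fintype L] [DecidableEq L]

/-- The plan that takes the action `g st` in each state `st`. -/
def Plan.ofState (g : DriverState L → Action L) : Plan L where
  prob _ st a := if a = g st then 1 else 0
  prob_nonneg h st a := by split_ifs <;> norm_num
  prob_sum h st := by simp

/-- Always provide service. -/
def Plan.serve : Plan L := Plan.ofState fun _ => none

/-- Provide service everywhere except at the location as whose type one is currently treated, from
where one relocates to `k`; once treated as a type-`k` driver, always provide service. -/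
def Plan.relocateTo (k : L) : Plan L :=
  Plan.ofState fun st => if st.loc = st.typ ∧ st.typ ≠ k then some k else none

/-- The total mass `x^{(τ)}` of drivers of reported type `τ` on the platform. -/
def Assignment.total (o : Assignment L) (τ : L) : ℝ := ∑ i, o.x i τ

/-- The probability that a driver treated as type `τ` who provides service at `i` is dispatched
to `j`.  If the platform has no type-`τ` drivers at `i`, such a driver stays at `i`. -/
noncomputable def Assignment.dispatch (o : Assignment L) (τ i j : L) : ℝ :=
  if o.x i τ = 0 then (if i = j then 1 else 0) else (o.f i j τ + o.y i j τ) / o.x i τ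

namespace Economy

variable (E : Economy L)

/-- The per-period value `W = w (1 - δ)` of the outside option. -/
def W : ℝ := E.w * (1 - E.δ)

/-- The mass of riders who request a trip from `i` to `j` at the price `q`. -/
noncomputable def demand (i j : L) (q : ℝ) : ℝ :=
  E.θ i * E.α i j * (1 - ProbabilityTheory.cdf (E.ν : MeasureTheory.Measure ℝ) q)

/-- The constraints of the platform's problem when the mass of drivers who reported type `τ`
is `s τ` (possibly infinite). -/
structure Feasible (s : L → ENNReal) (o : Assignment L) : Prop where
  price_nonneg : ∀ i j, 0 ≤ o.p i j
  f_nonneg : ∀ i j τ, 0 ≤ o.f i j τ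
  y_nonneg : ∀ i j τ, 0 ≤ o.y i j τ
  x_nonneg : ∀ i τ, 0 ≤ o.x i τ
  flow_in : ∀ i τ, o.x i τ = ∑ j, o.f j i τ + ∑ j, o.y j i τ
  market : ∀ i j, ∑ τ, o.f i j τ = E.demand i j (o.p i j)
  supply : ∀ τ, ENNReal.ofReal (∑ i, o.x i τ) ≤ s τ
  flow_out : ∀ i τ, ∑ j, o.y i j τ = o.x i τ - ∑ j, o.f i j τ

/-- The objective of the platform's problem. -/
def objective (o : Assignment L) : ℝ :=
  (∑ i, ∑ j, ∑ τ, o.f i j τ * o.p i j) - E.W * (∑ i, ∑ τ, o.x i τ) + E.I * ∑ τ, o.x τ τ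

/-- The additional constraint: no location holds more type-`τ` drivers than `τ` itself. -/
def PrefersHome (o : Assignment L) : Prop := ∀ i τ, o.x i τ ≤ o.x τ τ

/-- `o` solves the platform's problem with the additional constraint. -/
def IsOptimal (s : L → ENNReal) (o : Assignment L) : Prop :=
  (E.Feasible s o ∧ PrefersHome o) ∧
    ∀ o' : Assignment L, E.Feasible s o' → PrefersHome o' → E.objective o' ≤ E.objective o

/-- The linear system for reported type `τ`.  The unknowns are `π i k` (the utility, from `i` on,
of a driver of type `k` who reported `τ` and provides service everywhere except at `τ`, from where
she relocates to `k`) and the penalties `P k`. -/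
def PenaltySystem (o : Assignment L) (τ : L) (π : L → L → ℝ) (P : L → ℝ) : Prop :=
  (∀ i k, π i k =
      (if i ≠ τ then E.W + E.δ * ∑ j, (o.f i j τ + o.y i j τ) / o.x i τ * π j k else 0)
      + (if i = τ then E.δ * E.w - P k else 0) + (if i = k then E.I else 0)) ∧
  ∀ k, E.w = ∑ i, π i k * o.x i τ / o.total τ

/-- `o` is what PARM announces when the reported supply is `s`. -/
structure IsPARMOutcome (s : L → ENNReal) (o : Outcome L) : Prop where
  optimal : E.IsOptimal s o.toAssignment
  compensation : ∀ i j τ, o.c i j τ = E.W - if i = τ then E.I else 0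
  penalty : ∀ τ, 0 < o.total τ →
    ∃ π P, E.PenaltySystem o.toAssignment τ π P ∧ o.pen τ = max (⨆ k, P k) 0

/-- The platform's problem with the additional constraint has a solution at `s`. -/
def Solvable (s : L → ENNReal) : Prop := ∃ o, E.IsOptimal s o

/-- The mechanism `M`, a map from reported supplies to outcomes, is PARM. -/
def IsPARM (M : (L → ENNReal) → Outcome L) : Prop :=
  ∀ s, E.Solvable s → E.IsPARMOutcome s (M s)

/-- The expected utility in the current period of a driver of true type `k` in state `st` who
takes action `a`. -/
noncomputable def reward (o : Outcome L) (k : L) (st : DriverState L) : Action L → ℝ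
  | none => (∑ j, o.dispatch st.typ st.loc j * o.c st.loc j st.typ)
      + if st.loc = k then E.I else 0
  | some j => (if st.loc = k then E.I else 0)
      - if j ≠ st.typ ∧ st.deviated = false then o.pen st.typ else 0

end Economy

/-- The expectation of `g` at the next period's state: a driver who relocates to some `j` other than
the type as which she is treated has deviated, and is treated as a type-`j` driver from then on. -/
noncomputable def Outcome.next (o : Outcome L) (st : DriverState L) (g : DriverState L → ℝ) :
    Action L → ℝ
  | none => ∑ j, o.dispatch st.typ st.loc j * g ⟨j, st.typ, st.deviated⟩
  | some j => if j = st.typ then g ⟨j, st.typ, st.deviated⟩ else g ⟨j, j, true⟩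

namespace Economy

variable (E : Economy L)

/-- The expected utility `t` periods ahead, after the history `h` and in state `st`, of a driver of
true type `k` who follows the plan `σ`, all other drivers always providing service. -/
noncomputable def expectedReward (o : Outcome L) (k : L) (σ : Plan L) :
    ℕ → List (DriverState L × Action L) → DriverState L → ℝ
  | 0, h, st => ∑ a, σ.prob h st a * E.reward o k st a
  | t + 1, h, st => ∑ a, σ.prob h st a *
      o.next st (fun st' => expectedReward o k σ t (h ++ [(st, a)]) st') a

/-- The expected discounted lifetime utility of a driver of true type `k` who reported `τ`, follows
the plan `σ` and starts at `i`. -/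
noncomputable def lifetimeUtility (o : Outcome L) (k τ : L) (σ : Plan L) (i : L) : ℝ :=
  ∑' t : ℕ, E.δ ^ t * E.expectedReward o k σ t [] ⟨i, τ, false⟩

/-- The expected utility of a driver of true type `k` who reports `τ` and then follows `σ`.  Her
initial location is drawn from the steady-state distribution of the type-`τ` drivers.  If the
platform employs no type-`τ` drivers, she takes the outside option. -/
noncomputable def utility (o : Outcome L) (k τ : L) (σ : Plan L) : ℝ :=
  if 0 < o.total τ then ∑ i, o.x i τ / o.total τ * E.lifetimeUtility o k τ σ i else E.w

end Economy

/-- The mass of drivers reporting each type, if driver `ω` reports `r ω`. -/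
def reportedSupply {Ω : Type*} [MeasurableSpace Ω] (μ : MeasureTheory.Measure Ω) (r : Ω → L) :
    L → ENNReal :=
  fun τ => μ (r ⁻¹' {τ})

open Classical in
/-- In the mechanism `M` with the population `(Ω, μ)` of drivers, reporting truthfully and always
providing service is an ex post Nash equilibrium: whatever the true types `t` of all drivers (with
a solvable platform's problem), when all the others report truthfully and always provide service,
no driver `ω` gains by any report `τ` followed by any plan `σ`. -/
def Economy.TruthfulServiceIsExPostNash (E : Economy L) {Ω : Type*} [MeasurableSpace Ω]
    (μ : MeasureTheory.Measure Ω) (M : (L → ENNReal) → Outcome L) : Prop :=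
  ∀ t : Ω → L, (∀ τ, MeasurableSet (t ⁻¹' {τ})) → E.Solvable (reportedSupply μ t) →
    ∀ (ω : Ω) (τ : L) (σ : Plan L),
      E.utility (M (reportedSupply μ (Function.update t ω τ))) (t ω) τ σ
        ≤ E.utility (M (reportedSupply μ t)) (t ω) (t ω) Plan.serve

end Ridesharing

/-!
Along the path of a driver treated as type `τ`, the compensation `W - I` at `τ` and `W` elsewhere
gives every period the value `W = w (1 - δ)`, apart from two corrections: she loses `I` on each visit
to `τ` and gains `I` on each visit to her true preferred location `k`.  A truthful driver, with
`k = τ`, thus gets exactly `w` by always serving.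

Between two visits to `τ` a misreporting driver visits `k` at most once in expectation, because the
masses `x i τ` are invariant under the dispatch and `x k τ ≤ x τ τ` (`return_visits_le_one`).  So
starting at `τ` and always serving is worth at most `w` (`serveGain_nonpos`), and so is always
serving from the steady state (`sum_mul_pathValue_serveGain_le`).  In particular a driver who has
relocated to some `j`, and is treated as type `j`, has at most `w` left, whatever she does: a further
relocation costs her `W > I`.  With the target `k` she has exactly `w` left, so this is the best
deviation.  The penalty is large enough that deviating to `k` at the first visit to `τ` is worth at
most `w` in the steady state (`PenaltySystem.sum_mul_pathValue_le`); the linear system that defines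
it is uniquely solvable since its solution is affine in the penalty, with negative slope
(`existsUnique_penaltySystem`).

For arbitrary plans, the value of a driver who serves until she reaches `τ` and has `w + m` there is
`pathValue`, with `m` either the gain from serving forever or `-(W + pen τ)` from deviating.  The
larger `m` gives a function that satisfies the Bellman inequality for every action
(`IsPARMOutcome.bellman`), so no plan does better (`Feasible.lifetimeUtility_le`).  Finally, single
drivers are null sets, so a unilateral report leaves the outcome of the mechanism unchanged.
-/

namespace Ridesharing

/-! ### Discounted linear systems -/

section DiscountedSystems

variable {L : Type*} [Fintype L]

/-- A nonnegative kernel whose rows have mass at most one. -/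
structure IsSubstochastic (A : L → L → ℝ) : Prop where
  nonneg : ∀ i j, 0 ≤ A i j
  sum_le_one : ∀ i, ∑ j, A i j ≤ 1

/-- The maximum principle: at a point where `u` is largest, a positive value would be at most `δ`
times itself. -/
theorem IsSubstochastic.nonpos_of_le {A : L → L → ℝ} (hA : IsSubstochastic A) {δ : ℝ}
    (h0 : 0 ≤ δ) (h1 : δ < 1) {u : L → ℝ} (hu : ∀ i, u i ≤ δ * ∑ j, A i j * u j) (i : L) :
    u i ≤ 0 := by
  obtain ⟨m, -, hm⟩ := Finset.exists_max_image Finset.univ u ⟨i, Finset.mem_univ i⟩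
  refine (hm i (Finset.mem_univ i)).trans ?_
  by_contra! hpos
  have h2 : ∑ j, A m j * u j ≤ u m :=
    calc ∑ j, A m j * u j ≤ ∑ j, A m j * u m :=
          Finset.sum_le_sum fun j hj => mul_le_mul_of_nonneg_left (hm j hj) (hA.nonneg m j)
      _ = (∑ j, A m j) * u m := by rw [Finset.sum_mul]
      _ ≤ 1 * u m := mul_le_mul_of_nonneg_right (hA.sum_le_one m) hpos.le
      _ = u m := one_mul _
  have h3 := mul_le_mul_of_nonneg_left h2 h0
  nlinarith [hu m]

theorem IsSubstochastic.eq_zero_of_eq {A : L → L → ℝ} (hA : IsSubstochastic A) {δ : ℝ}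
    (h0 : 0 ≤ δ) (h1 : δ < 1) {u : L → ℝ} (hu : ∀ i, u i = δ * ∑ j, A i j * u j) (i : L) :
    u i = 0 := by
  refine le_antisymm (hA.nonpos_of_le h0 h1 (fun i => (hu i).le) i) ?_
  have := hA.nonpos_of_le h0 h1 (u := fun i => - u i) (fun i => ?_) i
  · linarith
  · simp only [mul_neg, Finset.sum_neg_distrib]
    exact (neg_inj.2 (hu i)).le

variable [DecidableEq L]

/-- The kernel `A` stopped at `τ`: from `τ` the process does not move on. -/
def killedAt (τ : L) (A : L → L → ℝ) (i j : L) : ℝ := if i = τ then 0 else A i j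

theorem IsSubstochastic.killedAt {A : L → L → ℝ} (hA : IsSubstochastic A) (τ : L) :
    IsSubstochastic (killedAt τ A) where
  nonneg i j := by
    unfold Ridesharing.killedAt
    split_ifs
    exacts [le_rfl, hA.nonneg i j]
  sum_le_one i := by
    unfold Ridesharing.killedAt
    split_ifs
    · simp
    · exact hA.sum_le_one i

theorem IsSubstochastic.exists_solution {A : L → L → ℝ} (hA : IsSubstochastic A) {δ : ℝ}
    (h0 : 0 ≤ δ) (h1 : δ < 1) (r : L → ℝ) :
    ∃ v : L → ℝ, ∀ i, v i = r i + δ * ∑ j, A i j * v j := by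
  let T : (L → ℝ) →ₗ[ℝ] (L → ℝ) := LinearMap.id - δ • Matrix.toLin' (Matrix.of A)
  have hT : ∀ v i, T v i = v i - δ * ∑ j, A i j * v j := fun v i => by
    simp [T, Matrix.mulVec, dotProduct]
  have hinj : Function.Injective T := by
    rw [← LinearMap.ker_eq_bot, LinearMap.ker_eq_bot']
    intro v hv
    funext i
    refine hA.eq_zero_of_eq h0 h1 (fun i => ?_) i
    have := congrFun hv i
    rw [hT] at this
    simpa [sub_eq_zero] using this
  obtain ⟨v, hv⟩ := LinearMap.injective_iff_surjective.1 hinj r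
  refine ⟨v, fun i => ?_⟩
  rw [← hv, hT]
  ring

open Classical in
/-- The expected discounted sum of `r` along the substochastic kernel `A`, that is, the solution
of `v = r + δ A v` (zero if there is none). -/
noncomputable def discountedSum (δ : ℝ) (A : L → L → ℝ) (r : L → ℝ) : L → ℝ :=
  if h : ∃ v : L → ℝ, ∀ i, v i = r i + δ * ∑ j, A i j * v j then h.choose else 0

theorem IsSubstochastic.discountedSum_eq {A : L → L → ℝ} (hA : IsSubstochastic A) {δ : ℝ}
    (h0 : 0 ≤ δ) (h1 : δ < 1) (r : L → ℝ) (i : L) :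
    discountedSum δ A r i = r i + δ * ∑ j, A i j * discountedSum δ A r j := by
  have h := hA.exists_solution h0 h1 r
  rw [discountedSum, dif_pos h]
  exact h.choose_spec i

theorem IsSubstochastic.discountedSum_nonneg {A : L → L → ℝ} (hA : IsSubstochastic A) {δ : ℝ}
    (h0 : 0 ≤ δ) (h1 : δ < 1) {r : L → ℝ} (hr : ∀ i, 0 ≤ r i) (i : L) :
    0 ≤ discountedSum δ A r i := by
  have := hA.nonpos_of_le h0 h1 (u := fun i => - discountedSum δ A r i) (fun i => ?_) i
  · linarith
  · simp only [mul_neg, Finset.sum_neg_distrib]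
    have := hA.discountedSum_eq h0 h1 r i
    linarith [hr i]

end DiscountedSystems

/-! ### The dispatch chain -/

namespace Economy

variable {L : Type*} [Fintype L] {E : Economy L} {s : L → ENNReal}

theorem I_lt_W (E : Economy L) : E.I < E.W :=
  (div_lt_iff₀ (sub_pos.2 E.δ_lt_one)).1 E.I_lt

theorem W_pos (E : Economy L) : 0 < E.W := E.I_nonneg.trans_lt E.I_lt_W

theorem Feasible.sum_out {o : Assignment L} (h : E.Feasible s o) (i τ : L) :
    ∑ j, (o.f i j τ + o.y i j τ) = o.x i τ := by
  rw [Finset.sum_add_distrib, h.flow_out]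
  ring

theorem Feasible.sum_in {o : Assignment L} (h : E.Feasible s o) (j τ : L) :
    ∑ i, (o.f i j τ + o.y i j τ) = o.x j τ := by
  rw [Finset.sum_add_distrib, h.flow_in j]

theorem Feasible.flow_nonneg {o : Assignment L} (h : E.Feasible s o) (i j τ : L) :
    0 ≤ o.f i j τ + o.y i j τ :=
  add_nonneg (h.f_nonneg i j τ) (h.y_nonneg i j τ)

theorem Feasible.flow_eq_zero_of_source {o : Assignment L} (h : E.Feasible s o) {i τ : L}
    (hi : o.x i τ = 0) (j : L) : o.f i j τ + o.y i j τ = 0 :=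
  (Finset.sum_eq_zero_iff_of_nonneg fun j _ => h.flow_nonneg i j τ).1
    ((h.sum_out i τ).trans hi) j (Finset.mem_univ j)

theorem Feasible.flow_eq_zero_of_target {o : Assignment L} (h : E.Feasible s o) {j τ : L}
    (hj : o.x j τ = 0) (i : L) : o.f i j τ + o.y i j τ = 0 :=
  (Finset.sum_eq_zero_iff_of_nonneg fun i _ => h.flow_nonneg i j τ).1
    ((h.sum_in j τ).trans hj) i (Finset.mem_univ i)

theorem PrefersHome.x_home_pos {o : Assignment L} (hP : PrefersHome o) {τ : L}
    (hτ : 0 < o.total τ) : 0 < o.x τ τ := by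
  by_contra! hx
  exact hτ.not_ge (Finset.sum_nonpos fun i _ => (hP i τ).trans hx)

theorem sum_x_div_total {o : Assignment L} {τ : L} (hτ : 0 < o.total τ) :
    ∑ i, o.x i τ / o.total τ = 1 := by
  rw [← Finset.sum_div]
  exact div_self hτ.ne'

variable [DecidableEq L]

theorem Feasible.dispatch_nonneg {o : Assignment L} (h : E.Feasible s o) (τ i j : L) :
    0 ≤ o.dispatch τ i j := by
  unfold Assignment.dispatch
  split_ifs
  exacts [zero_le_one, le_rfl, div_nonneg (h.flow_nonneg i j τ) (h.x_nonneg i τ)]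

theorem Feasible.sum_dispatch {o : Assignment L} (h : E.Feasible s o) (τ i : L) :
    ∑ j, o.dispatch τ i j = 1 := by
  unfold Assignment.dispatch
  split_ifs with hx
  · simp
  · rw [← Finset.sum_div, h.sum_out, div_self hx]

theorem Feasible.isSubstochastic_dispatch {o : Assignment L} (h : E.Feasible s o) (τ : L) :
    IsSubstochastic (o.dispatch τ) :=
  ⟨h.dispatch_nonneg τ, fun i => (h.sum_dispatch τ i).le⟩

theorem Feasible.mul_dispatch {o : Assignment L} (h : E.Feasible s o) (τ i j : L) :
    o.x i τ * o.dispatch τ i j = o.f i j τ + o.y i j τ := by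
  unfold Assignment.dispatch
  split_ifs with hx hij
  · rw [hx, h.flow_eq_zero_of_source hx, zero_mul]
  · rw [hx, h.flow_eq_zero_of_source hx, zero_mul]
  · rw [mul_div_cancel₀ _ hx]

/-- The masses `x i τ` are invariant under the dispatch of type-`τ` drivers. -/
theorem Feasible.sum_mul_dispatch {o : Assignment L} (h : E.Feasible s o) (τ : L) (u : L → ℝ) :
    ∑ i, o.x i τ * ∑ j, o.dispatch τ i j * u j = ∑ j, o.x j τ * u j := by
  simp_rw [Finset.mul_sum, ← mul_assoc, h.mul_dispatch]
  rw [Finset.sum_comm]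
  simp_rw [← Finset.sum_mul, h.sum_in]

/-- The expected discounted number of periods that a driver treated as type `τ`, always serving,
spends at `k` before she reaches `τ`, as a function of her location. -/
noncomputable def visits (E : Economy L) (o : Assignment L) (k τ : L) : L → ℝ :=
  discountedSum E.δ (killedAt τ (o.dispatch τ)) fun i => if i = k ∧ i ≠ τ then 1 else 0

/-- The expectation of `δ ^ T`, where `T` is the time at which a driver treated as type `τ`, always
serving, reaches `τ`, as a function of her location. -/
noncomputable def hitting (E : Economy L) (o : Assignment L) (τ : L) : L → ℝ :=
  discountedSum E.δ (killedAt τ (o.dispatch τ)) fun i => if i = τ then 1 else 0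

section Visits

variable {o : Assignment L} (k τ : L)

theorem Feasible.visits_home (h : E.Feasible s o) : E.visits o k τ τ = 0 := by
  rw [visits, ((h.isSubstochastic_dispatch τ).killedAt τ).discountedSum_eq E.δ_pos.le E.δ_lt_one]
  simp [killedAt]

theorem Feasible.visits_of_ne (h : E.Feasible s o) {i : L} (hi : i ≠ τ) :
    E.visits o k τ i
      = (if i = k then 1 else 0) + E.δ * ∑ j, o.dispatch τ i j * E.visits o k τ j := by
  rw [visits, ((h.isSubstochastic_dispatch τ).killedAt τ).discountedSum_eq E.δ_pos.le E.δ_lt_one]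
  simp [killedAt, hi]

theorem Feasible.hitting_home (h : E.Feasible s o) : E.hitting o τ τ = 1 := by
  rw [hitting, ((h.isSubstochastic_dispatch τ).killedAt τ).discountedSum_eq E.δ_pos.le E.δ_lt_one]
  simp [killedAt]

theorem Feasible.hitting_of_ne (h : E.Feasible s o) {i : L} (hi : i ≠ τ) :
    E.hitting o τ i = E.δ * ∑ j, o.dispatch τ i j * E.hitting o τ j := by
  rw [hitting, ((h.isSubstochastic_dispatch τ).killedAt τ).discountedSum_eq E.δ_pos.le E.δ_lt_one]
  simp [killedAt, hi]

theorem Feasible.visits_nonneg (h : E.Feasible s o) (i : L) : 0 ≤ E.visits o k τ i :=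
  ((h.isSubstochastic_dispatch τ).killedAt τ).discountedSum_nonneg E.δ_pos.le E.δ_lt_one
    (fun i => by split_ifs <;> norm_num) i

theorem Feasible.hitting_le_one (h : E.Feasible s o) (i : L) : E.hitting o τ i ≤ 1 := by
  have := ((h.isSubstochastic_dispatch τ).killedAt τ).nonpos_of_le E.δ_pos.le E.δ_lt_one
    (u := fun i => E.hitting o τ i - 1) (fun i => ?_) i
  · linarith
  · by_cases hi : i = τ
    · subst hi
      simp [killedAt, h.hitting_home]
    · simp only [killedAt, if_neg hi, mul_sub, mul_one, Finset.sum_sub_distrib, h.sum_dispatch,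
        ← h.hitting_of_ne τ hi]
      linarith [E.δ_lt_one]

theorem Feasible.sum_dispatch_hitting_le_one (h : E.Feasible s o) (i : L) :
    ∑ j, o.dispatch τ i j * E.hitting o τ j ≤ 1 := by
  rw [← h.sum_dispatch τ i]
  exact Finset.sum_le_sum fun j _ =>
    mul_le_of_le_one_right (h.dispatch_nonneg τ i j) (h.hitting_le_one τ j)

theorem Feasible.visits_self (h : E.Feasible s o) (i : L) : E.visits o k k i = 0 := by
  refine ((h.isSubstochastic_dispatch k).killedAt k).eq_zero_of_eq E.δ_pos.le E.δ_lt_one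
    (fun i => ?_) i
  by_cases hi : i = k
  · subst hi
    simp [killedAt, h.visits_home]
  · simp only [killedAt, if_neg hi]
    rw [h.visits_of_ne k k hi, if_neg hi, zero_add]

/-- Between two visits to her home location a driver visits `k` at most once in expectation: weigh
the equations for `visits` with the invariant masses, and use that `k` holds no more type-`τ`
drivers than `τ`. -/
theorem Feasible.return_visits_le_one (h : E.Feasible s o) (hP : PrefersHome o) :
    E.δ * ∑ j, o.dispatch τ τ j * E.visits o k τ j ≤ 1 := by
  by_cases hkτ : k = τ
  · subst hkτ
    simp [h.visits_self]
  by_cases hx : o.x τ τ = 0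
  · simp [Assignment.dispatch, hx, h.visits_home]
  have hpos : 0 < o.x τ τ := (h.x_nonneg τ τ).lt_of_ne' hx
  set q := ∑ j, o.dispatch τ τ j * E.visits o k τ j with hq
  have key : ∑ i, o.x i τ * E.visits o k τ i
      = o.x k τ + E.δ * ∑ i, o.x i τ * ∑ j, o.dispatch τ i j * E.visits o k τ j
        - o.x τ τ * (E.δ * q) := by
    have hi : ∀ i, o.x i τ * E.visits o k τ i
        = (if i = k then o.x i τ else 0)
          + E.δ * (o.x i τ * ∑ j, o.dispatch τ i j * E.visits o k τ j)
          - (if i = τ then o.x i τ * (E.δ * q) else 0) := by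
      intro i
      by_cases hi : i = τ
      · subst hi
        rw [h.visits_home, if_neg (Ne.symm hkτ), if_pos rfl]
        ring
      · rw [if_neg hi, h.visits_of_ne k τ hi]
        split_ifs <;> ring
    rw [Finset.sum_congr rfl fun i _ => hi i, Finset.sum_sub_distrib, Finset.sum_add_distrib,
      ← Finset.mul_sum]
    simp
  rw [h.sum_mul_dispatch] at key
  have hS : 0 ≤ ∑ i, o.x i τ * E.visits o k τ i :=
    Finset.sum_nonneg fun i _ => mul_nonneg (h.x_nonneg i τ) (h.visits_nonneg k τ i)
  have h1 : o.x τ τ * (E.δ * q) ≤ o.x τ τ * 1 := by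
    nlinarith [hP k τ, E.δ_lt_one]
  exact le_of_mul_le_mul_left h1 hpos

end Visits

end Economy

/-! ### The penalty system -/

namespace Economy

variable {L : Type*} [Fintype L] {E : Economy L} {s : L → ENNReal}

/-- The coefficients of the penalty system form a substochastic kernel: a row with `x i τ = 0`
vanishes, as division by zero gives zero, and every other row sums to one. -/
theorem Feasible.isSubstochastic_flow_div {o : Assignment L} (h : E.Feasible s o) (τ : L) :
    IsSubstochastic fun i j => (o.f i j τ + o.y i j τ) / o.x i τ where
  nonneg i j := div_nonneg (h.flow_nonneg i j τ) (h.x_nonneg i τ)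
  sum_le_one i := by
    rw [← Finset.sum_div, h.sum_out]
    exact div_self_le_one _

variable [DecidableEq L]

/-- The system is solved by `π = a - P b`, where `a` is the value without penalty and `b i`, the
expectation of `δ ^ T` for the time `T` of the first visit to `τ`, does not depend on `P`.  The
second equation is then affine in `P` with slope `- ∑ i, b i * x i τ / total < 0`. -/
theorem Feasible.existsUnique_penaltySystem {o : Assignment L} (h : E.Feasible s o)
    (hP : PrefersHome o) {τ : L} (hτ : 0 < o.total τ) :
    ∃! q : (L → L → ℝ) × (L → ℝ), E.PenaltySystem o τ q.1 q.2 := by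
  have h0 := E.δ_pos.le
  have h1 := E.δ_lt_one
  set A : L → L → ℝ := killedAt τ fun i j => (o.f i j τ + o.y i j τ) / o.x i τ with hA
  have hAs : IsSubstochastic A := (h.isSubstochastic_flow_div τ).killedAt τ
  have hsum : ∀ (u : L → ℝ) (i : L), ∑ j, A i j * u j
      = if i = τ then 0 else ∑ j, (o.f i j τ + o.y i j τ) / o.x i τ * u j := by
    intro u i
    simp only [hA, killedAt]
    split_ifs <;> simp
  set a : L → L → ℝ := fun k => discountedSum E.δ A fun i =>
    (if i ≠ τ then E.W else 0) + (if i = τ then E.δ * E.w else 0) + (if i = k then E.I else 0)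
    with ha
  set b : L → ℝ := discountedSum E.δ A fun i => if i = τ then 1 else 0 with hb
  have ha' : ∀ k i, a k i = (if i ≠ τ then E.W else 0) + (if i = τ then E.δ * E.w else 0)
      + (if i = k then E.I else 0) + E.δ * ∑ j, A i j * a k j :=
    fun k i => hAs.discountedSum_eq h0 h1 _ i
  have hb' : ∀ i, b i = (if i = τ then 1 else 0) + E.δ * ∑ j, A i j * b j :=
    fun i => hAs.discountedSum_eq h0 h1 _ i
  have hbτ : b τ = 1 := by simpa [hsum] using hb' τ
  have hb0 : ∀ i, 0 ≤ b i :=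
    fun i => hAs.discountedSum_nonneg h0 h1 (fun i => by split_ifs <;> norm_num) i
  have hB : 0 < ∑ i, b i * o.x i τ :=
    Finset.sum_pos' (fun i _ => mul_nonneg (hb0 i) (h.x_nonneg i τ))
      ⟨τ, Finset.mem_univ τ, by rw [hbτ, one_mul]; exact hP.x_home_pos hτ⟩
  -- The first equation determines `π` by uniqueness for the kernel `A`; the second one is then a
  -- linear equation for `P k`.
  have hsys : ∀ (π : L → L → ℝ) (P : L → ℝ), E.PenaltySystem o τ π P ↔
      (∀ i k, π i k = a k i - P k * b i) ∧
        ∀ k, P k * ∑ i, b i * o.x i τ = ∑ i, a k i * o.x i τ - E.w * o.total τ := by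
    intro π P
    have hfirst : (∀ i k, π i k =
        (if i ≠ τ then E.W + E.δ * ∑ j, (o.f i j τ + o.y i j τ) / o.x i τ * π j k else 0)
        + (if i = τ then E.δ * E.w - P k else 0) + (if i = k then E.I else 0)) ↔
        ∀ i k, π i k = a k i - P k * b i := by
      rw [forall_comm, forall_comm (β := L) (p := fun i k => π i k = a k i - P k * b i)]
      refine forall_congr' fun k => ⟨fun hπ i => ?_, fun hπ i => ?_⟩
      · have := hAs.eq_zero_of_eq h0 h1 (u := fun i => π i k - a k i + P k * b i) (fun i => ?_) i
        · linarith
        · simp only [mul_add, mul_sub, Finset.sum_add_distrib, Finset.sum_sub_distrib,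
            mul_left_comm _ (P k), ← Finset.mul_sum]
          have e1 := hπ i
          have e2 := ha' k i
          have e3 := hb' i
          rw [hsum (fun j => π j k)]
          by_cases hi : i = τ
          · simp only [hi, ne_eq, not_true_eq_false, if_true, if_false] at e1 e2 e3 ⊢
            linear_combination e1 - e2 + P k * e3
          · simp only [hi, ne_eq, not_false_eq_true, if_true, if_false] at e1 e2 e3 ⊢
            linear_combination e1 - e2 + P k * e3
      · have e2 := ha' k i
        have e3 := hb' i
        simp only [hπ, mul_sub, Finset.sum_sub_distrib, mul_left_comm _ (P k), ← Finset.mul_sum]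
        rw [hsum] at e2 e3
        by_cases hi : i = τ
        · simp only [hi, ne_eq, not_true_eq_false, if_true, if_false] at e2 e3 ⊢
          linear_combination e2 - P k * e3
        · simp only [hi, ne_eq, not_false_eq_true, if_true, if_false] at e2 e3 ⊢
          linear_combination e2 - P k * e3
    unfold PenaltySystem
    rw [hfirst]
    refine and_congr_right fun hπ => forall_congr' fun k => ?_
    rw [← Finset.sum_div, eq_div_iff hτ.ne']
    simp only [hπ, sub_mul, Finset.sum_sub_distrib, mul_assoc, ← Finset.mul_sum]
    constructor <;> intro e <;> linarith
  refine ⟨(fun i k => a k i - (∑ i, a k i * o.x i τ - E.w * o.total τ)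
      / (∑ i, b i * o.x i τ) * b i,
    fun k => (∑ i, a k i * o.x i τ - E.w * o.total τ) / ∑ i, b i * o.x i τ), ?_, ?_⟩
  · exact (hsys _ _).2 ⟨fun i k => rfl, fun k => div_mul_cancel₀ _ hB.ne'⟩
  · rintro ⟨π, P⟩ hq
    obtain ⟨q1, q2⟩ := (hsys _ _).1 hq
    have hPk : ∀ k, P k = (∑ i, a k i * o.x i τ - E.w * o.total τ) / ∑ i, b i * o.x i τ :=
      fun k => (eq_div_iff hB.ne').2 (q2 k)
    refine Prod.ext ?_ (funext hPk)
    funext i k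
    change π i k = a k i - (∑ i, a k i * o.x i τ - E.w * o.total τ) / (∑ i, b i * o.x i τ) * b i
    rw [← hPk k]
    exact q1 i k

end Economy

/-! ### Plans and their values -/

theorem DriverState.exists_abs_le {L : Type*} [Finite L] (Z : DriverState L → ℝ) :
    ∃ B, ∀ st, |Z st| ≤ B := by
  have : Finite (DriverState L) :=
    Finite.of_injective (fun st : DriverState L => (st.loc, st.typ, st.deviated)) fun
      | ⟨_, _, _⟩, ⟨_, _, _⟩, hst => by simpa using hst
  obtain ⟨B, hB⟩ := (Set.finite_range fun st => |Z st|).bddAbove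
  exact ⟨B, fun st => hB ⟨st, rfl⟩⟩

theorem Plan.sum_prob_mul_le {L : Type*} [Fintype L] (σ : Plan L)
    (hist : List (DriverState L × Action L)) (st : DriverState L) {g : Action L → ℝ} {c : ℝ}
    (hg : ∀ a, g a ≤ c) :
    ∑ a, σ.prob hist st a * g a ≤ c :=
  calc _ ≤ ∑ a, σ.prob hist st a * c :=
        Finset.sum_le_sum fun a _ => mul_le_mul_of_nonneg_left (hg a) (σ.prob_nonneg hist st a)
    _ = c := by rw [← Finset.sum_mul, σ.prob_sum, one_mul]

variable {L : Type*} [Fintype L] [DecidableEq L]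

theorem Outcome.next_sum {ι : Type*} (o : Outcome L) (st : DriverState L) (S : Finset ι)
    (c : ι → ℝ) (g : ι → DriverState L → ℝ) (a : Action L) :
    o.next st (fun st' => ∑ t ∈ S, c t * g t st') a = ∑ t ∈ S, c t * o.next st (g t) a := by
  cases a with
  | none =>
    simp only [Outcome.next, Finset.mul_sum]
    rw [Finset.sum_comm]
    exact Finset.sum_congr rfl fun t _ => Finset.sum_congr rfl fun j _ => mul_left_comm _ _ _
  | some j =>
    simp only [Outcome.next]
    split_ifs <;> rfl

theorem Outcome.next_sub (o : Outcome L) (st : DriverState L) (g g' : DriverState L → ℝ)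
    (a : Action L) :
    o.next st (fun st' => g st' - g' st') a = o.next st g a - o.next st g' a := by
  cases a with
  | none => simp only [Outcome.next, mul_sub, Finset.sum_sub_distrib]
  | some j =>
    simp only [Outcome.next]
    split_ifs <;> rfl

namespace Economy

variable {E : Economy L} {s : L → ENNReal} {o : Outcome L}

/-- If `g ≤ g' + c` on a set of states that contains all states possible in the next period, the
expectations satisfy the same inequality. -/
theorem Feasible.next_le (h : E.Feasible s o.toAssignment) {st : DriverState L}
    {g g' : DriverState L → ℝ} {c : ℝ}
    (hstay : ∀ j, g ⟨j, st.typ, st.deviated⟩ ≤ g' ⟨j, st.typ, st.deviated⟩ + c)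
    (hdev : ∀ j, g ⟨j, j, true⟩ ≤ g' ⟨j, j, true⟩ + c) (a : Action L) :
    o.next st g a ≤ o.next st g' a + c := by
  cases a with
  | none =>
    simp only [Outcome.next]
    calc _ ≤ ∑ j, o.dispatch st.typ st.loc j * (g' ⟨j, st.typ, st.deviated⟩ + c) :=
          Finset.sum_le_sum fun j _ =>
            mul_le_mul_of_nonneg_left (hstay j) (h.dispatch_nonneg _ _ _)
      _ = _ := by
          simp only [mul_add, Finset.sum_add_distrib, ← Finset.sum_mul, h.sum_dispatch, one_mul]
  | some j =>
    simp only [Outcome.next]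
    split_ifs
    exacts [hstay j, hdev j]

theorem Feasible.abs_next_le (h : E.Feasible s o.toAssignment) (st : DriverState L)
    {g : DriverState L → ℝ} {c : ℝ} (hg : ∀ st, |g st| ≤ c) (a : Action L) :
    |o.next st g a| ≤ c := by
  have hz : o.next st (fun _ => 0) a = 0 := by cases a <;> simp [Outcome.next]
  have hup := h.next_le (st := st) (g := g) (g' := fun _ => 0) (c := c)
    (fun j => by simpa using (abs_le.1 (hg _)).2) (fun j => by simpa using (abs_le.1 (hg _)).2) a
  have hlo := h.next_le (st := st) (g := fun _ => 0) (g' := g) (c := c)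
    (fun j => by linarith [(abs_le.1 (hg ⟨j, st.typ, st.deviated⟩)).1])
    (fun j => by linarith [(abs_le.1 (hg ⟨j, j, true⟩)).1]) a
  rw [abs_le]
  constructor <;> linarith

theorem Feasible.exists_abs_expectedReward_le (h : E.Feasible s o.toAssignment) (k : L)
    (σ : Plan L) : ∃ C, ∀ t hist st, |E.expectedReward o k σ t hist st| ≤ C := by
  have hbd : ∀ a, ∃ C, ∀ st, |E.reward o k st a| ≤ C :=
    fun a => DriverState.exists_abs_le fun st => E.reward o k st a
  choose C hC using hbd
  have hle : ∀ st a, |E.reward o k st a| ≤ ∑ a, |C a| := fun st a =>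
    ((hC a st).trans (le_abs_self _)).trans
      (Finset.single_le_sum (f := fun a => |C a|) (fun a _ => abs_nonneg _) (Finset.mem_univ a))
  have habs : ∀ hist st (g : Action L → ℝ), (∀ a, |g a| ≤ ∑ a, |C a|) →
      |∑ a, σ.prob hist st a * g a| ≤ ∑ a, |C a| := by
    intro hist st g hg
    refine (Finset.abs_sum_le_sum_abs _ _).trans ?_
    simp_rw [abs_mul, abs_of_nonneg (σ.prob_nonneg _ _ _)]
    exact σ.sum_prob_mul_le hist st hg
  -- Expectations preserve the bound on the rewards of a single period.
  refine ⟨∑ a, |C a|, fun t => ?_⟩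
  induction t with
  | zero => exact fun hist st => habs hist st _ (hle st)
  | succ t ih => exact fun hist st => habs hist st _ fun a => h.abs_next_le st (ih _) a

theorem Feasible.summable_expectedReward (h : E.Feasible s o.toAssignment) (k : L) (σ : Plan L)
    (hist : List (DriverState L × Action L)) (st : DriverState L) :
    Summable fun t : ℕ => E.δ ^ t * E.expectedReward o k σ t hist st := by
  obtain ⟨C, hC⟩ := h.exists_abs_expectedReward_le k σ
  refine Summable.of_norm_bounded
    ((summable_geometric_of_lt_one E.δ_pos.le E.δ_lt_one).mul_right C) fun t => ?_
  rw [Real.norm_eq_abs, abs_mul, abs_of_nonneg (pow_nonneg E.δ_pos.le t)]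
  exact mul_le_mul_of_nonneg_left (hC t hist st) (pow_nonneg E.δ_pos.le t)

/-- The expected discounted utility from the first `n` periods. -/
noncomputable def partialUtility (E : Economy L) (o : Outcome L) (k : L) (σ : Plan L) (n : ℕ)
    (hist : List (DriverState L × Action L)) (st : DriverState L) : ℝ :=
  ∑ t ∈ Finset.range n, E.δ ^ t * E.expectedReward o k σ t hist st

theorem partialUtility_succ (E : Economy L) (o : Outcome L) (k : L) (σ : Plan L) (n : ℕ)
    (hist : List (DriverState L × Action L)) (st : DriverState L) :
    E.partialUtility o k σ (n + 1) hist st = ∑ a, σ.prob hist st a * (E.reward o k st a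
      + E.δ * o.next st (E.partialUtility o k σ n (hist ++ [(st, a)])) a) := by
  have hnext : ∀ a, o.next st (E.partialUtility o k σ n (hist ++ [(st, a)])) a
      = ∑ t ∈ Finset.range n,
          E.δ ^ t * o.next st (E.expectedReward o k σ t (hist ++ [(st, a)])) a :=
    fun a => o.next_sum st _ _ _ a
  rw [partialUtility, Finset.sum_range_succ']
  simp only [hnext, mul_add, Finset.sum_add_distrib, pow_zero, one_mul, expectedReward]
  rw [add_comm]
  congr 1
  simp only [Finset.mul_sum]
  rw [Finset.sum_comm]
  refine Finset.sum_congr rfl fun a _ => Finset.sum_congr rfl fun t _ => ?_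
  rw [pow_succ]
  ring

theorem Feasible.tendsto_partialUtility (h : E.Feasible s o.toAssignment) (k τ : L) (σ : Plan L)
    (i : L) : Filter.Tendsto (fun n => E.partialUtility o k σ n [] ⟨i, τ, false⟩) Filter.atTop
      (nhds (E.lifetimeUtility o k τ σ i)) :=
  (h.summable_expectedReward k σ [] ⟨i, τ, false⟩).hasSum.tendsto_sum_nat

/-- Verification: if no action in any state that can occur after the report `τ` improves upon `Z`
in the Bellman equation, no plan gives more than `Z`. -/
theorem Feasible.lifetimeUtility_le (h : E.Feasible s o.toAssignment) {k τ : L}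
    {Z : DriverState L → ℝ}
    (hZ : ∀ st, st.deviated = true ∨ st.typ = τ → ∀ a,
      E.reward o k st a + E.δ * o.next st Z a ≤ Z st) (σ : Plan L) (i : L) :
    E.lifetimeUtility o k τ σ i ≤ Z ⟨i, τ, false⟩ := by
  obtain ⟨B, hB⟩ := DriverState.exists_abs_le Z
  have key : ∀ n hist st, st.deviated = true ∨ st.typ = τ →
      E.partialUtility o k σ n hist st ≤ Z st + E.δ ^ n * B := by
    intro n
    induction n with
    | zero =>
      intro hist st _
      have := (abs_le.1 (hB st)).1
      simp only [partialUtility, Finset.range_zero, Finset.sum_empty, pow_zero]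
      linarith
    | succ n ih =>
      intro hist st hst
      rw [partialUtility_succ]
      refine σ.sum_prob_mul_le hist st fun a => ?_
      have hn := h.next_le (st := st) (g := E.partialUtility o k σ n (hist ++ [(st, a)]))
        (g' := Z) (c := E.δ ^ n * B) (fun j => ih _ _ hst) (fun j => ih _ _ (Or.inl rfl)) a
      calc _ ≤ E.reward o k st a + E.δ * (o.next st Z a + E.δ ^ n * B) := by
            have := mul_le_mul_of_nonneg_left hn E.δ_pos.le
            linarith
        _ ≤ _ := by
            rw [pow_succ]
            linarith [hZ st hst a]
  have hlim : Filter.Tendsto (fun n : ℕ => Z ⟨i, τ, false⟩ + E.δ ^ n * B) Filter.atTop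
      (nhds (Z ⟨i, τ, false⟩)) := by
    simpa using ((tendsto_pow_atTop_nhds_zero_of_lt_one E.δ_pos.le E.δ_lt_one).mul_const
      B).const_add (Z ⟨i, τ, false⟩)
  exact le_of_tendsto_of_tendsto' (h.tendsto_partialUtility k τ σ i) hlim
    fun n => key n [] _ (Or.inr rfl)

/-- A function that solves the evaluation equation of a stationary plan is its value. -/
theorem Feasible.lifetimeUtility_ofState (h : E.Feasible s o.toAssignment) {k : L}
    {g : DriverState L → Action L} {Z : DriverState L → ℝ}
    (hZ : ∀ st, Z st = E.reward o k st (g st) + E.δ * o.next st Z (g st)) (τ i : L) :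
    E.lifetimeUtility o k τ (Plan.ofState g) i = Z ⟨i, τ, false⟩ := by
  obtain ⟨B, hB⟩ := DriverState.exists_abs_le Z
  have key : ∀ n hist st,
      |E.partialUtility o k (Plan.ofState g) n hist st - Z st| ≤ E.δ ^ n * B := by
    intro n
    induction n with
    | zero =>
      intro hist st
      simpa [partialUtility] using hB st
    | succ n ih =>
      intro hist st
      rw [partialUtility_succ]
      simp only [Plan.ofState, ite_mul, one_mul, zero_mul, Finset.sum_ite_eq', Finset.mem_univ,
        if_true]
      rw [hZ st, add_sub_add_left_eq_sub, ← mul_sub, ← Outcome.next_sub, abs_mul,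
        abs_of_pos E.δ_pos, pow_succ', mul_assoc]
      exact mul_le_mul_of_nonneg_left (h.abs_next_le st (ih _) _) E.δ_pos.le
  have hlim : Filter.Tendsto (fun n : ℕ => E.δ ^ n * B) Filter.atTop (nhds 0) := by
    simpa using (tendsto_pow_atTop_nhds_zero_of_lt_one E.δ_pos.le E.δ_lt_one).mul_const B
  refine tendsto_nhds_unique (h.tendsto_partialUtility k τ _ i) ?_
  rw [tendsto_iff_dist_tendsto_zero]
  exact squeeze_zero (fun _ => dist_nonneg) (fun n => key n [] _) hlim

end Economy

/-! ### Values of service and relocation -/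

namespace Economy

variable {E : Economy L} {s : L → ENNReal}

/-- The lifetime utility at `i` of a driver of true type `k`, treated as type `τ`, who serves until
she reaches `τ` and whose value there is `w + m`. -/
noncomputable def pathValue (E : Economy L) (o : Assignment L) (k τ : L) (m : ℝ) (i : L) : ℝ :=
  E.w + E.I * E.visits o k τ i + m * E.hitting o τ i

/-- The amount by which always serving from `τ` on, treated as type `τ`, exceeds the outside option
for a driver of true type `k`.  She forgoes `I` at `τ` (unless `k = τ`), collects `I` at `k`, and
faces the same situation upon her return. -/
noncomputable def serveGain (E : Economy L) (o : Assignment L) (k τ : L) : ℝ :=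
  ((if τ = k then E.I else 0) - E.I
      + E.I * (E.δ * ∑ j, o.dispatch τ τ j * E.visits o k τ j))
    / (1 - E.δ * ∑ j, o.dispatch τ τ j * E.hitting o τ j)

section Assignment

variable {o : Assignment L} (k τ : L)

theorem Feasible.return_discount_le (h : E.Feasible s o) :
    E.δ * ∑ j, o.dispatch τ τ j * E.hitting o τ j ≤ E.δ :=
  mul_le_of_le_one_right E.δ_pos.le (h.sum_dispatch_hitting_le_one τ τ)

theorem Feasible.return_discount_lt_one (h : E.Feasible s o) :
    E.δ * ∑ j, o.dispatch τ τ j * E.hitting o τ j < 1 :=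
  (h.return_discount_le τ).trans_lt E.δ_lt_one

theorem Feasible.serveGain_mul (h : E.Feasible s o) :
    E.serveGain o k τ * (1 - E.δ * ∑ j, o.dispatch τ τ j * E.hitting o τ j)
      = (if τ = k then E.I else 0) - E.I
        + E.I * (E.δ * ∑ j, o.dispatch τ τ j * E.visits o k τ j) :=
  div_mul_cancel₀ _ (sub_pos.2 (h.return_discount_lt_one τ)).ne'

theorem Feasible.serveGain_self (h : E.Feasible s o) : E.serveGain o k k = 0 := by
  simp [serveGain, h.visits_self]

theorem Feasible.serveGain_nonpos (h : E.Feasible s o) (hP : PrefersHome o) :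
    E.serveGain o k τ ≤ 0 := by
  by_cases hk : τ = k
  · rw [hk, h.serveGain_self]
  · refine div_nonpos_of_nonpos_of_nonneg ?_ (sub_pos.2 (h.return_discount_lt_one τ)).le
    rw [if_neg hk]
    have := mul_le_mul_of_nonneg_left (h.return_visits_le_one k τ hP) E.I_nonneg
    linarith

/-- Returning to `τ` for free instead of serving does not pay: with `m = serveGain`, the inequality
says that `I 1{τ = k} + δ (w + m) ≤ w + m`. -/
theorem Feasible.neg_W_le_serveGain (h : E.Feasible s o) (hP : PrefersHome o) :
    (if τ = k then E.I else 0) - E.W ≤ (1 - E.δ) * E.serveGain o k τ := by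
  by_cases hk : τ = k
  · rw [if_pos hk, hk, h.serveGain_self]
    linarith [E.I_lt_W]
  · have e := h.serveGain_mul k τ
    have hv : 0 ≤ E.I * (E.δ * ∑ j, o.dispatch τ τ j * E.visits o k τ j) :=
      mul_nonneg E.I_nonneg (mul_nonneg E.δ_pos.le (Finset.sum_nonneg fun j _ =>
        mul_nonneg (h.dispatch_nonneg _ _ _) (h.visits_nonneg k τ j)))
    have hle := mul_le_mul_of_nonpos_left
      (sub_le_sub_left (h.return_discount_le τ) 1) (h.serveGain_nonpos k τ hP)
    rw [if_neg hk] at e ⊢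
    linarith [E.I_lt_W]

theorem Feasible.pathValue_home (h : E.Feasible s o) (m : ℝ) :
    E.pathValue o k τ m τ = E.w + m := by
  simp [pathValue, h.visits_home, h.hitting_home]

theorem Feasible.sum_dispatch_pathValue (h : E.Feasible s o) (m : ℝ) (i : L) :
    ∑ j, o.dispatch τ i j * E.pathValue o k τ m j
      = E.w + E.I * ∑ j, o.dispatch τ i j * E.visits o k τ j
        + m * ∑ j, o.dispatch τ i j * E.hitting o τ j := by
  simp only [pathValue, mul_add, Finset.sum_add_distrib, ← Finset.sum_mul, h.sum_dispatch,
    one_mul, Finset.mul_sum, mul_left_comm]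

theorem Feasible.pathValue_of_ne (h : E.Feasible s o) (m : ℝ) {i : L} (hi : i ≠ τ) :
    E.pathValue o k τ m i = E.W + (if i = k then E.I else 0)
      + E.δ * ∑ j, o.dispatch τ i j * E.pathValue o k τ m j := by
  rw [h.sum_dispatch_pathValue, pathValue, h.visits_of_ne k τ hi, h.hitting_of_ne τ hi, W]
  split_ifs <;> ring

/-- Serving once from `τ` and obtaining `w + m` upon the return falls short of `w + m` by the
discounted difference between `m` and `serveGain`. -/
theorem Feasible.serve_home (h : E.Feasible s o) (m : ℝ) :
    E.W - E.I + (if τ = k then E.I else 0)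
        + E.δ * ∑ j, o.dispatch τ τ j * E.pathValue o k τ m j
      = E.pathValue o k τ m τ - (m - E.serveGain o k τ)
        * (1 - E.δ * ∑ j, o.dispatch τ τ j * E.hitting o τ j) := by
  rw [h.sum_dispatch_pathValue, h.pathValue_home, sub_mul, h.serveGain_mul, W]
  ring

/-- Away from `τ`, serving on is at least as good as relocating to `τ` would be if an unpaid period
cost nothing: the arrival at `τ` is discounted at least once, which favours waiting as `m ≤ 0`. -/
theorem Feasible.le_pathValue_of_ne (h : E.Feasible s o) {m : ℝ} (hm : m ≤ 0) {i : L}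
    (hi : i ≠ τ) :
    E.w + (if i = k then E.I else 0) + E.δ * m ≤ E.pathValue o k τ m i := by
  have h1 : E.hitting o τ i ≤ E.δ := by
    rw [h.hitting_of_ne τ hi]
    exact mul_le_of_le_one_right E.δ_pos.le (h.sum_dispatch_hitting_le_one τ i)
  have h2 : (if i = k then (1 : ℝ) else 0) ≤ E.visits o k τ i := by
    rw [h.visits_of_ne k τ hi]
    exact le_add_of_nonneg_right (mul_nonneg E.δ_pos.le (Finset.sum_nonneg fun j _ =>
      mul_nonneg (h.dispatch_nonneg _ _ _) (h.visits_nonneg k τ j)))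
  have h3 := mul_le_mul_of_nonneg_left h2 E.I_nonneg
  have h4 := mul_le_mul_of_nonpos_left h1 hm
  rw [mul_ite, mul_one, mul_zero] at h3
  rw [pathValue]
  linarith

/-- In the steady state a misreporting driver who always serves loses `I` on her visits to `τ` and
gains `I` on her visits to `k`, which are no more frequent. -/
theorem Feasible.sum_mul_pathValue_serveGain_le (h : E.Feasible s o) (hP : PrefersHome o) :
    ∑ i, o.x i τ * E.pathValue o k τ (E.serveGain o k τ) i ≤ E.w * o.total τ := by
  set v := E.pathValue o k τ (E.serveGain o k τ) with hv
  have hi : ∀ i, o.x i τ * v i = o.x i τ * E.W - (if i = τ then o.x i τ * E.I else 0)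
      + (if i = k then o.x i τ * E.I else 0)
      + E.δ * (o.x i τ * ∑ j, o.dispatch τ i j * v j) := by
    intro i
    have : v i = E.W - (if i = τ then E.I else 0) + (if i = k then E.I else 0)
        + E.δ * ∑ j, o.dispatch τ i j * v j := by
      by_cases hi : i = τ
      · subst hi
        have := h.serve_home k i (E.serveGain o k i)
        rw [sub_self, zero_mul, sub_zero] at this
        rw [if_pos rfl, hv, ← this]
      · rw [if_neg hi, sub_zero]
        exact h.pathValue_of_ne k τ _ hi
    rw [this]
    split_ifs <;> ring
  have hS : ∑ i, o.x i τ * v i = o.total τ * E.W - o.x τ τ * E.I + o.x k τ * E.I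
      + E.δ * ∑ i, o.x i τ * v i := by
    conv_lhs => rw [Finset.sum_congr rfl fun i _ => hi i]
    rw [Finset.sum_add_distrib, Finset.sum_add_distrib, Finset.sum_sub_distrib, ← Finset.mul_sum,
      ← Finset.sum_mul, h.sum_mul_dispatch]
    simp [Assignment.total]
  have hx := mul_le_mul_of_nonneg_right (hP k τ) E.I_nonneg
  refine le_of_mul_le_mul_left ?_ (sub_pos.2 E.δ_lt_one)
  have : E.W = E.w * (1 - E.δ) := rfl
  rw [this] at hS
  linarith

/-- If the penalty is at least the value `P k` that solves the penalty system, serving up to the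
first visit to `τ` and relocating to `k` from there is worth at most `w` in the steady state. -/
theorem PenaltySystem.sum_mul_pathValue_le {π : L → L → ℝ} {P : L → ℝ} {q : ℝ} {k τ : L}
    (hπ : E.PenaltySystem o τ π P) (h : E.Feasible s o) (hτ : 0 < o.total τ) (hk : k ≠ τ)
    (hq : P k ≤ q) :
    ∑ i, o.x i τ * E.pathValue o k τ (-(E.W + q)) i ≤ E.w * o.total τ := by
  set v := E.pathValue o k τ (-(E.W + q)) with hv
  have hw : E.w * o.total τ = ∑ i, o.x i τ * π i k := by
    have := hπ.2 k
    rw [← Finset.sum_div, eq_div_iff hτ.ne'] at this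
    rw [this]
    exact Finset.sum_congr rfl fun i _ => mul_comm _ _
  rw [hw]
  -- Locations without drivers of type `τ` are never reached, and there the two values may differ.
  set u : L → ℝ := fun i => if o.x i τ = 0 then 0 else v i - π i k with hu
  have hu0 : ∀ i, u i ≤ 0 := by
    refine ((h.isSubstochastic_flow_div τ).killedAt τ).nonpos_of_le E.δ_pos.le E.δ_lt_one
      fun i => ?_
    by_cases hx : o.x i τ = 0
    · simp [killedAt, hu, hx]
    by_cases hi : i = τ
    · subst hi
      have h1 := hπ.1 i k
      simp only [ne_eq, not_true_eq_false, if_true, if_false, Ne.symm hk] at h1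
      have h2 : v i = E.w + -(E.W + q) := h.pathValue_home k i _
      have h3 : E.W = E.w * (1 - E.δ) := rfl
      simp only [hu, hx, if_false, killedAt, if_true, zero_mul, Finset.sum_const_zero, mul_zero]
      linarith
    · have h1 := hπ.1 i k
      simp only [ne_eq, hi, not_false_eq_true, if_true, if_false] at h1
      have h2 : v i = _ := h.pathValue_of_ne k τ _ hi
      have h3 : ∑ j, killedAt τ (fun i j => (o.f i j τ + o.y i j τ) / o.x i τ) i j * u j
          = ∑ j, o.dispatch τ i j * v j
            - ∑ j, (o.f i j τ + o.y i j τ) / o.x i τ * π j k := by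
        rw [← Finset.sum_sub_distrib]
        refine Finset.sum_congr rfl fun j _ => ?_
        simp only [killedAt, if_neg hi, Assignment.dispatch, if_neg hx, hu]
        by_cases hj : o.x j τ = 0
        · simp [h.flow_eq_zero_of_target hj i]
        · rw [if_neg hj, mul_sub]
      rw [h3]
      simp only [hu, hx, if_false]
      linarith
  refine Finset.sum_le_sum fun i _ => ?_
  by_cases hx : o.x i τ = 0
  · simp [hx]
  · have := hu0 i
    simp only [hu, hx, if_false] at this
    exact mul_le_mul_of_nonneg_left (by linarith) (h.x_nonneg i τ)

end Assignment

/-! ### Plans under PARM -/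

variable {o : Outcome L}

theorem IsPARMOutcome.feasible (hO : E.IsPARMOutcome s o) : E.Feasible s o.toAssignment :=
  hO.optimal.1.1

theorem IsPARMOutcome.prefersHome (hO : E.IsPARMOutcome s o) : PrefersHome o.toAssignment :=
  hO.optimal.1.2

theorem IsPARMOutcome.pen_nonneg (hO : E.IsPARMOutcome s o) {τ : L} (hτ : 0 < o.total τ) :
    0 ≤ o.pen τ := by
  obtain ⟨π, P, -, hpen⟩ := hO.penalty τ hτ
  rw [hpen]
  exact le_max_right _ _

theorem IsPARMOutcome.reward_none (hO : E.IsPARMOutcome s o) (k : L) (st : DriverState L) :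
    E.reward o k st none = E.W - (if st.loc = st.typ then E.I else 0)
      + if st.loc = k then E.I else 0 := by
  simp only [reward, hO.compensation, ← Finset.sum_mul, hO.feasible.sum_dispatch, one_mul]

theorem IsPARMOutcome.serve_eq (hO : E.IsPARMOutcome s o) (k : L) (st : DriverState L) (m : ℝ) :
    E.reward o k st none
        + E.δ * ∑ j, o.dispatch st.typ st.loc j * E.pathValue o.toAssignment k st.typ m j
      = E.pathValue o.toAssignment k st.typ m st.loc
        - if st.loc = st.typ then (m - E.serveGain o.toAssignment k st.typ)
          * (1 - E.δ * ∑ j, o.dispatch st.typ st.typ j * E.hitting o.toAssignment st.typ j)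
          else 0 := by
  rw [hO.reward_none]
  by_cases hst : st.loc = st.typ
  · rw [if_pos hst, if_pos hst, hst]
    exact hO.feasible.serve_home k st.typ m
  · rw [if_neg hst, if_neg hst, sub_zero, sub_zero]
    exact (hO.feasible.pathValue_of_ne k st.typ m hst).symm

theorem IsPARMOutcome.serve_le (hO : E.IsPARMOutcome s o) (k : L) (st : DriverState L) {m : ℝ}
    (hm : E.serveGain o.toAssignment k st.typ ≤ m) :
    E.reward o k st none
        + E.δ * ∑ j, o.dispatch st.typ st.loc j * E.pathValue o.toAssignment k st.typ m j
      ≤ E.pathValue o.toAssignment k st.typ m st.loc := by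
  rw [hO.serve_eq]
  have := mul_nonneg (sub_nonneg.2 hm)
    (sub_pos.2 (hO.feasible.return_discount_lt_one st.typ)).le
  split_ifs <;> linarith

theorem IsPARMOutcome.lifetimeUtility_serve (hO : E.IsPARMOutcome s o) (k τ i : L) :
    E.lifetimeUtility o k τ Plan.serve i
      = E.pathValue o.toAssignment k τ (E.serveGain o.toAssignment k τ) i := by
  refine hO.feasible.lifetimeUtility_ofState (g := fun _ => none) (Z := fun st =>
    E.pathValue o.toAssignment k st.typ (E.serveGain o.toAssignment k st.typ) st.loc)
    (fun st => ?_) τ i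
  have := hO.serve_eq k st (E.serveGain o.toAssignment k st.typ)
  rw [sub_self, zero_mul, ite_self, sub_zero] at this
  exact this.symm

theorem IsPARMOutcome.lifetimeUtility_relocateTo (hO : E.IsPARMOutcome s o) {k τ : L}
    (hk : k ≠ τ) (i : L) :
    E.lifetimeUtility o k τ (Plan.relocateTo k) i
      = E.pathValue o.toAssignment k τ (-(E.W + o.pen τ)) i := by
  have hF := hO.feasible
  have hW : E.W = E.w * (1 - E.δ) := rfl
  -- A driver of true type `k` who is treated as type `k` earns `W` in every period that she serves.
  refine (hF.lifetimeUtility_ofState (k := k) (Z := fun st => if st.typ = k then E.w else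
    E.pathValue o.toAssignment k st.typ (-(E.W + if st.deviated = false then o.pen st.typ else 0))
      st.loc) (fun st => ?_) τ i).trans (by simp [Ne.symm hk])
  by_cases hst : st.typ = k
  · have hr := hO.reward_none k st
    simp only [hst, sub_add_cancel] at hr
    simp only [hst, ne_eq, not_true_eq_false, and_false, if_true, if_false, hr, Outcome.next,
      ← Finset.sum_mul, hF.sum_dispatch]
    linarith
  · by_cases hloc : st.loc = st.typ
    · simp only [reward, Outcome.next, hloc, hst, Ne.symm hst, ne_eq, not_false_eq_true, and_self,
        true_and, if_true, if_false, hF.pathValue_home]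
      linarith
    · have := hO.serve_eq k st (-(E.W + if st.deviated = false then o.pen st.typ else 0))
      rw [if_neg hloc, sub_zero] at this
      simp only [hst, hloc, false_and, if_false, Outcome.next]
      exact this.symm

/-- The Bellman inequality for the better one of the two values of always serving and relocating to
`k`.  Once treated as a type that she has relocated to, a driver gets at most `w`, since serving
gains nothing there and a relocation costs a compensation `W > I`.  Hence a first deviation is worth
at most `w - W - pen τ` whatever its target, and at a location other than `τ` it is better to wait
for the arrival at `τ`. -/
theorem IsPARMOutcome.bellman (hO : E.IsPARMOutcome s o) {τ : L} (hτ : 0 < o.total τ) (k : L)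
    (st : DriverState L) (hst : st.deviated = true ∨ st.typ = τ) (a : Action L) :
    let Z : DriverState L → ℝ := fun st => E.pathValue o.toAssignment k st.typ
      (if st.deviated = true then 0
        else max (E.serveGain o.toAssignment k st.typ) (-(E.W + o.pen st.typ))) st.loc
    E.reward o k st a + E.δ * o.next st Z a ≤ Z st := by
  intro Z
  have hF := hO.feasible
  have hP := hO.prefersHome
  have hW : E.W = E.w * (1 - E.δ) := rfl
  have hIW := E.I_lt_W
  have hI0 := E.I_nonneg
  have hdev : ∀ j, Z ⟨j, j, true⟩ = E.w := fun j => by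
    simp [Z, hF.pathValue_home]
  obtain ⟨i, κ, d⟩ := st
  cases d with
  | true =>
    cases a with
    | none =>
      exact hO.serve_le k ⟨i, κ, true⟩ (hF.serveGain_nonpos k κ hP)
    | some j =>
      have hnext : o.next ⟨i, κ, true⟩ Z (some j) = E.w := by
        simp only [Outcome.next]
        split_ifs with hj
        · rw [hj, hdev]
        · rw [hdev]
      have hZ : E.w ≤ Z ⟨i, κ, true⟩ := by
        simp only [Z, if_true, pathValue, zero_mul, add_zero]
        exact le_add_of_nonneg_right (mul_nonneg hI0 (hF.visits_nonneg k κ i))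
      rw [hnext]
      simp only [reward, Bool.true_eq_false, and_false, if_false]
      split_ifs <;> linarith
  | false =>
    obtain rfl : κ = τ := by simpa using hst
    have hpen := hO.pen_nonneg hτ
    set m := max (E.serveGain o.toAssignment k κ) (-(E.W + o.pen κ)) with hm
    have hZ : ∀ j, Z ⟨j, κ, false⟩ = E.pathValue o.toAssignment k κ m j := fun j => by
      simp [Z, hm]
    have hm0 : m ≤ 0 := max_le (hF.serveGain_nonpos k κ hP) (by linarith [E.W_pos])
    have hδm : m ≤ E.δ * m := by nlinarith [E.δ_lt_one]
    have hm1 : (if κ = k then E.I else 0) - E.W ≤ (1 - E.δ) * m :=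
      (hF.neg_W_le_serveGain k κ hP).trans
        (mul_le_mul_of_nonneg_left (le_max_left _ _) (sub_pos.2 E.δ_lt_one).le)
    have hm2 : (if κ = k then E.I else 0) - E.W - o.pen κ ≤ m := by
      by_cases hκ : κ = k
      · have : E.serveGain o.toAssignment k κ ≤ m := le_max_left _ _
        rw [hκ, hF.serveGain_self] at this
        rw [if_pos hκ]
        linarith
      · have : -(E.W + o.pen κ) ≤ m := le_max_right _ _
        rw [if_neg hκ]
        linarith
    have hm3 : -(E.W + o.pen κ) ≤ m := le_max_right _ _
    rw [hZ i]
    cases a with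
    | none =>
      have := hO.serve_le k ⟨i, κ, false⟩ (m := m) (le_max_left _ _)
      simpa only [Outcome.next, hZ] using this
    | some j =>
      by_cases hj : j = κ
      · simp only [reward, Outcome.next, hj, if_true, ne_eq, not_true_eq_false, false_and,
          if_false, sub_zero, hZ, hF.pathValue_home]
        by_cases hi : i = κ
        · rw [hi, hF.pathValue_home]
          linarith
        · have := hF.le_pathValue_of_ne k κ hm0 hi
          linarith [E.W_pos]
      · simp only [reward, Outcome.next, hj, if_false, ne_eq, not_false_eq_true, and_self,
          if_true, hdev]
        by_cases hi : i = κ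
        · rw [hi, hF.pathValue_home]
          linarith
        · have := hF.le_pathValue_of_ne k κ hm0 hi
          linarith

theorem utility_le_of_lifetimeUtility_le (hF : E.Feasible s o.toAssignment) {k τ : L}
    {σ σ' : Plan L} (hσ : ∀ i, E.lifetimeUtility o k τ σ i ≤ E.lifetimeUtility o k τ σ' i) :
    E.utility o k τ σ ≤ E.utility o k τ σ' := by
  unfold utility
  split_ifs with hτ
  · exact Finset.sum_le_sum fun i _ =>
      mul_le_mul_of_nonneg_left (hσ i) (div_nonneg (hF.x_nonneg i τ) hτ.le)
  · exact le_rfl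

theorem utility_le_of_sum_le {k τ : L} {σ : Plan L} (hτ : 0 < o.total τ)
    (hσ : ∑ i, o.x i τ * E.lifetimeUtility o k τ σ i ≤ E.w * o.total τ) :
    E.utility o k τ σ ≤ E.w := by
  rw [utility, if_pos hτ]
  simp_rw [div_mul_eq_mul_div]
  rw [← Finset.sum_div]
  exact (div_le_iff₀ hτ).2 hσ

theorem IsPARMOutcome.utility_serve_self (hO : E.IsPARMOutcome s o) (k : L) :
    E.utility o k k Plan.serve = E.w := by
  unfold utility
  split_ifs with hτ
  · simp only [hO.lifetimeUtility_serve, pathValue, hO.feasible.visits_self,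
      hO.feasible.serveGain_self, mul_zero, zero_mul, add_zero, ← Finset.sum_mul,
      sum_x_div_total hτ, one_mul]
  · rfl

theorem IsPARMOutcome.utility_serve_le (hO : E.IsPARMOutcome s o) {τ : L} (hτ : 0 < o.total τ)
    (k : L) : E.utility o k τ Plan.serve ≤ E.w := by
  refine utility_le_of_sum_le hτ ?_
  simp only [hO.lifetimeUtility_serve]
  exact hO.feasible.sum_mul_pathValue_serveGain_le k τ hO.prefersHome

theorem IsPARMOutcome.utility_relocateTo_le (hO : E.IsPARMOutcome s o) {k τ : L}
    (hτ : 0 < o.total τ) (hk : k ≠ τ) : E.utility o k τ (Plan.relocateTo k) ≤ E.w := by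
  obtain ⟨π, P, hπ, hpen⟩ := hO.penalty τ hτ
  refine utility_le_of_sum_le hτ ?_
  simp only [hO.lifetimeUtility_relocateTo hk]
  refine hπ.sum_mul_pathValue_le hO.feasible hτ hk ?_
  rw [hpen]
  exact (le_ciSup (Set.finite_range P).bddAbove k).trans (le_max_left _ _)

theorem IsPARMOutcome.lifetimeUtility_le (hO : E.IsPARMOutcome s o) {τ : L} (hτ : 0 < o.total τ)
    (k : L) (σ : Plan L) (i : L) :
    E.lifetimeUtility o k τ σ i ≤ E.pathValue o.toAssignment k τ
      (max (E.serveGain o.toAssignment k τ) (-(E.W + o.pen τ))) i := by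
  have := hO.feasible.lifetimeUtility_le (fun st hst a => hO.bellman hτ k st hst a) σ i
  simpa using this

theorem IsPARMOutcome.utility_le_max (hO : E.IsPARMOutcome s o) {k τ : L} (hτ : 0 < o.total τ)
    (hk : k ≠ τ) (σ : Plan L) :
    E.utility o k τ σ ≤
      max (E.utility o k τ Plan.serve) (E.utility o k τ (Plan.relocateTo k)) := by
  have hle := hO.lifetimeUtility_le hτ k σ
  rcases max_choice (E.serveGain o.toAssignment k τ) (-(E.W + o.pen τ)) with hm | hm <;>
    rw [hm] at hle
  · refine le_max_of_le_left (utility_le_of_lifetimeUtility_le hO.feasible fun i => ?_)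
    rw [hO.lifetimeUtility_serve]
    exact hle i
  · refine le_max_of_le_right (utility_le_of_lifetimeUtility_le hO.feasible fun i => ?_)
    rw [hO.lifetimeUtility_relocateTo hk]
    exact hle i

theorem IsPARMOutcome.utility_le (hO : E.IsPARMOutcome s o) (k τ : L) (σ : Plan L) :
    E.utility o k τ σ ≤ E.w := by
  by_cases hτ : 0 < o.total τ
  · by_cases hk : k = τ
    · subst hk
      rw [← hO.utility_serve_self k]
      refine utility_le_of_lifetimeUtility_le hO.feasible fun i => ?_
      refine (hO.lifetimeUtility_le hτ k σ i).trans ?_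
      have hneg : -(E.W + o.pen k) ≤ 0 := by linarith [E.W_pos, hO.pen_nonneg hτ]
      rw [hO.lifetimeUtility_serve, hO.feasible.serveGain_self, max_eq_left hneg]
    · exact (hO.utility_le_max hτ hk σ).trans
        (max_le (hO.utility_serve_le hτ k) (hO.utility_relocateTo_le hτ hk))
  · rw [utility, if_neg hτ]

end Economy

/-! ### The report of a single driver -/

open Classical in
/-- A single driver is a null set, so her report does not change the supply. -/
theorem reportedSupply_update {L Ω : Type*} [MeasurableSpace Ω] (μ : MeasureTheory.Measure Ω)
    [MeasureTheory.NullSingletonClass μ] (t : Ω → L) (ω : Ω) (τ : L) :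
    reportedSupply μ (Function.update t ω τ) = reportedSupply μ t := by
  funext κ
  refine MeasureTheory.measure_congr ?_
  have hne : ∀ᵐ ω' ∂μ, ω' ≠ ω := by
    simp [MeasureTheory.ae_iff]
  filter_upwards [hne] with ω' hω'
  change (Function.update t ω τ ω' = κ) = (t ω' = κ)
  rw [Function.update_of_ne hω']

end Ridesharing

theorem mainTheorem1 {L : Type*} [Fintype L] [DecidableEq L] (E : Ridesharing.Economy L)
    {Ω : Type*} [MeasurableSpace Ω] (μ : MeasureTheory.Measure Ω) [MeasureTheory.NullSingletonClass μ]
    (M : (L → ENNReal) → Ridesharing.Outcome L) (hM : E.IsPARM M) :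
    E.TruthfulServiceIsExPostNash μ M ∧
    ∀ s : L → ENNReal, E.Solvable s →
      (∀ (k τ i : L) (σ : Ridesharing.Plan L),
        Summable fun t : ℕ => E.δ ^ t * E.expectedReward (M s) k σ t [] ⟨i, τ, false⟩) ∧
      (∀ k : L, E.utility (M s) k k Ridesharing.Plan.serve = E.w) ∧
      ∀ τ : L, 0 < (M s).total τ →
        (∃! q : (L → L → ℝ) × (L → ℝ), E.PenaltySystem (M s).toAssignment τ q.1 q.2) ∧
        ∀ k : L, k ≠ τ →
          E.utility (M s) k τ (Ridesharing.Plan.relocateTo k) ≤ E.w ∧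
          ∀ σ : Ridesharing.Plan L,
            E.utility (M s) k τ σ ≤
              max (E.utility (M s) k τ Ridesharing.Plan.serve)
                (E.utility (M s) k τ (Ridesharing.Plan.relocateTo k)) := by
  refine ⟨fun t _ hs ω τ σ => ?_, fun s hs => ?_⟩
  · rw [Ridesharing.reportedSupply_update, (hM _ hs).utility_serve_self]
    exact (hM _ hs).utility_le _ τ σ
  · have hO := hM s hs
    exact ⟨fun k τ i σ => hO.feasible.summable_expectedReward k σ [] _, hO.utility_serve_self,
      fun τ hτ => ⟨hO.feasible.existsUnique_penaltySystem hO.prefersHome hτ, fun k hk =>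
        ⟨hO.utility_relocateTo_le hτ hk, hO.utility_le_max hτ hk⟩⟩⟩
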